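/- Let $\delta>-1$ be a constant and let $(G(n))_{n\ge 1}$ be the linear preferential attachment model in which every new node attaches to an existing node (Model A): $G(1)$ consists of one node $v_1$ with a self loop (so $v_1$ has degree $2$), and, given $G(n)$ with nodes $v_1,\dots,v_n$, the graph $G(n+1)$ is obtained by adding a node $v_{n+1}$ and one edge joining it to one of the existing nodes, the node $v_i$ being chosen with probability $$\frac{D_i(n)+\delta}{\sum_{j=1}^n (D_j(n)+\delta)}=\frac{D_i(n)+\delta}{(2+\delta)n},\qquad 1\le i\le n,$$ where $D_i(n)$ is the degree of $v_i$ in $G(n)$. Let $D_{(1)}(n)\ge D_{(2)}(n)\ge\dots\ge D_{(n)}(n)$ be the order statistics of $D_1(n),\dots,D_n(n)$. Let $(k_n)$ be a sequence of nonnegative integers with $$\liminf_{n\to\infty}\frac{k_n}{(n\log n)^{1/2}}>0\qquad\text{and}\qquad \frac{k_n}{n}\to 0\quad (n\to\infty).$$ Let $M_+((0,\infty])$ be the space of nonnegative Radon measures on $(0,\infty]$ with the vague topology, let $\epsilon_x$ be the unit mass at $x$, and let $\nu_{2+\delta}$ be the measure on $(0,\infty]$ with $\nu_{2+\delta}(x,\infty]=x^{-(2+\delta)}$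 for $x>0$. **Theorem.** (i) The tail empirical measure $$\hat\nu_n=\frac1{k_n}\sum_{i=1}^n \epsilon_{D_i(n)/D_{(k_n)}(n)}$$ converges weakly (in distribution, as a random element of $M_+((0,\infty])$) to the deterministic measure $\nu_{2+\delta}$ as $n\to\infty$. (ii) With $$b(x)=\left(\frac{\Gamma(3+2\delta)}{\Gamma(1+\delta)}\right)^{\frac1{2+\delta}}x^{\frac1{2+\delta}},$$ one has, for every fixed $t>0$, $$\frac{D_{([k_nt])}(n)}{b(n/k_n)}\longrightarrow t^{-\frac1{2+\delta}}\quad\text{in probability as } n\to\infty,$$ where $[\cdot]$ denotes the integer part. -/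

import Mathlib

open MeasureTheory ProbabilityTheory Filter Topology Set
open scoped ENNReal NNReal CompactlySupported

noncomputable section

/-! ## The preferential attachment graphs -/

/-- Finite undirected multigraphs with vertices labelled by natural numbers, given by the multiset
of their edges; the edge `s(i, i)` is a self loop at `i`. -/
abbrev LabelledMultigraph : Type := Multiset (Sym2 ℕ)

/-- The degree of vertex `i` in `g`: the number of edge ends at `i` (a self loop counts twice). -/
def LabelledMultigraph.degree (g : LabelledMultigraph) (i : ℕ) : ℕ :=
  (g.map fun e => e.toMultiset.count i).sum

/-- `G 1, G 2, …` is a linear preferential attachment process with parameter `δ` in which every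
new vertex attaches to one of the existing vertices. `G 1` is the single vertex `1` with a self
loop. Given `G n = g` (a graph on the vertices `1, …, n`), the graph `G (n + 1)` is obtained by
adding the vertex `n + 1` and an edge from it to `i ∈ {1, …, n}`, with probability
`(deg_g i + δ) / ∑ j ≤ n, (deg_g j + δ)`. The value `G 0` plays no role. -/
structure IsPreferentialAttachmentA {Ω : Type*} [MeasurableSpace Ω] (P : Measure Ω) (δ : ℝ)
    (G : ℕ → Ω → LabelledMultigraph) : Prop where
  measurableSet_eq : ∀ n, 1 ≤ n → ∀ g, MeasurableSet {ω | G n ω = g}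
  init : ∀ᵐ ω ∂P, G 1 ω = {s(1, 1)}
  step : ∀ n, 1 ≤ n → ∀ g : LabelledMultigraph, P {ω | G n ω = g} ≠ 0 →
    ∀ i ∈ Finset.Icc 1 n,
      (P[|{ω | G n ω = g}]).real {ω | G (n + 1) ω = s(n + 1, i) ::ₘ g} =
        ((g.degree i : ℝ) + δ) / ∑ j ∈ Finset.Icc 1 n, ((g.degree j : ℝ) + δ)

/-- The order statistic `D_(j)(n)`: the `j`-th largest (`1 ≤ j ≤ n`) of the degrees of the
vertices `1, …, n` of `g`, counted with multiplicity. -/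
def LabelledMultigraph.orderedDegree (g : LabelledMultigraph) (n j : ℕ) : ℕ :=
  (((Finset.Icc 1 n).val.map g.degree).sort (· ≥ ·)).getD (j - 1) 0

/-! ## Radon measures on `(0, ∞]` with the vague topology -/

/-- The space `(0, ∞]`, as a subspace of `[0, ∞]`. Its compact subsets are the closed subsets
which are bounded away from `0`. -/
abbrev PosExtended : Type := Set.Ioi (0 : ℝ≥0∞)

/-- `M_+(E)`, the nonnegative Radon measures on `E`. It is used for `E` locally compact, Hausdorff
and second countable, where these are the Borel measures that are finite on compact sets. -/
def RadonMeasures (E : Type*) [TopologicalSpace E] [MeasurableSpace E] : Type _ :=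
  {μ : Measure E // IsFiniteMeasureOnCompacts μ}

namespace RadonMeasures

variable {E : Type*} [TopologicalSpace E] [MeasurableSpace E]

/-- The vague topology: the coarsest topology that makes `μ ↦ ∫ f dμ` continuous for every
continuous compactly supported `f`. -/
instance : TopologicalSpace (RadonMeasures E) :=
  TopologicalSpace.induced (fun (μ : RadonMeasures E) (f : C_c(E, ℝ)) => ∫ x, f x ∂μ.1)
    Pi.topologicalSpace

/-- `M_+(E)` carries the Borel σ-algebra of the vague topology. -/
instance : MeasurableSpace (RadonMeasures E) := borel _

instance : BorelSpace (RadonMeasures E) := ⟨rfl⟩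

end RadonMeasures

/-- The restriction to `(0, ∞]` of a finite measure on `[0, ∞]`, as an element of
`M_+((0, ∞])`. -/
def restrictPosExtended (μ : Measure ℝ≥0∞) [IsFiniteMeasure μ] : RadonMeasures PosExtended :=
  ⟨μ.comap Subtype.val, inferInstance⟩

/-- The tail empirical measure `(1 / k) ∑_{i = 1}^n ε_{D_i(n) / D_(k)(n)}` on `(0, ∞]`. -/
def tailEmpiricalMeasure (g : LabelledMultigraph) (n k : ℕ) : RadonMeasures PosExtended :=
  restrictPosExtended ((k : ℝ≥0)⁻¹ • ∑ i ∈ Finset.Icc 1 n,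
    Measure.dirac ((g.degree i : ℝ≥0∞) / (g.orderedDegree n k : ℝ≥0∞)))

/-- The measure with density `α y ^ (-α - 1)` on `(0, ∞)` and no mass at `∞`. -/
def powerMeasure (α : ℝ) : Measure PosExtended :=
  Measure.comap Subtype.val (Measure.map ENNReal.ofReal
    ((volume.restrict (Set.Ioi 0)).withDensity fun y : ℝ => ENNReal.ofReal (α * y ^ (-α - 1))))

theorem powerMeasure_apply (α : ℝ) {x : ℝ} (hx : 0 < x) :
    powerMeasure α {y | ENNReal.ofReal x < y.1} =
      ∫⁻ y in Set.Ioi x, ENNReal.ofReal (α * y ^ (-α - 1)) := by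
  have hme : MeasurableEmbedding (Subtype.val : PosExtended → ℝ≥0∞) :=
    MeasurableEmbedding.subtype_coe measurableSet_Ioi
  rw [powerMeasure, hme.comap_apply]
  have h1 : (Subtype.val '' {y : PosExtended | ENNReal.ofReal x < y.1}) =
      Set.Ioi (ENNReal.ofReal x) := by
    ext z
    constructor
    · rintro ⟨y, hy, rfl⟩
      exact hy
    · intro hz
      exact ⟨⟨z, Set.mem_Ioi.2 (lt_of_le_of_lt (zero_le (a := ENNReal.ofReal x)) hz)⟩, hz, rfl⟩
  have h2 : ENNReal.ofReal ⁻¹' Set.Ioi (ENNReal.ofReal x) = Set.Ioi x := by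
    ext z
    simp only [Set.mem_preimage, Set.mem_Ioi]
    constructor
    · intro h
      exact (ENNReal.ofReal_lt_ofReal_iff_of_nonneg hx.le).1 h
    · intro h
      exact (ENNReal.ofReal_lt_ofReal_iff_of_nonneg hx.le).2 h
  rw [h1, Measure.map_apply ENNReal.measurable_ofReal measurableSet_Ioi, h2,
    withDensity_apply _ measurableSet_Ioi, Measure.restrict_restrict measurableSet_Ioi,
    Set.inter_eq_left.2 (Set.Ioi_subset_Ioi hx.le)]

/-- `ν_α (x, ∞] = x ^ (-α)`. -/
theorem powerMeasure_Ioi {α x : ℝ} (hα : 0 < α) (hx : 0 < x) :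
    powerMeasure α {y | ENNReal.ofReal x < y.1} = ENNReal.ofReal (x ^ (-α)) := by
  have hlt : -α - 1 < -1 := by linarith
  rw [powerMeasure_apply α hx, ← ofReal_integral_eq_lintegral_ofReal
    ((integrableOn_Ioi_rpow_of_lt hlt hx).const_mul α), integral_const_mul,
    integral_Ioi_rpow_of_lt hlt hx]
  · congr 1
    rw [show -α - 1 + 1 = -α by ring]
    field_simp
  · refine (ae_restrict_iff' measurableSet_Ioi).2 (Eventually.of_forall fun y hy => ?_)
    have : 0 < y := hx.trans hy
    show 0 ≤ α * y ^ (-α - 1)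
    positivity

theorem powerMeasure_Ioi_lt_top (α : ℝ) {x : ℝ} (hx : 0 < x) :
    powerMeasure α {y | ENNReal.ofReal x < y.1} < ∞ := by
  rcases lt_or_ge 0 α with hα | hα
  · rw [powerMeasure_Ioi hα hx]
    exact ENNReal.ofReal_lt_top
  · rw [powerMeasure_apply α hx, setLIntegral_congr_fun (g := fun _ => 0) measurableSet_Ioi]
    · simp
    · intro y hy
      have : 0 < y := hx.trans hy
      exact ENNReal.ofReal_of_nonpos (mul_nonpos_of_nonpos_of_nonneg hα (by positivity))

/-- `ν_α` as an element of `M_+((0, ∞])`. -/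
def nuMeasure (α : ℝ) : RadonMeasures PosExtended :=
  ⟨powerMeasure α, by
    have : IsLocallyFiniteMeasure (powerMeasure α) := by
      refine ⟨fun y => ?_⟩
      obtain ⟨r, hr0, hr⟩ := ENNReal.lt_iff_exists_real_btwn.1 (show (0 : ℝ≥0∞) < y.1 from y.2)
      refine ⟨{z | ENNReal.ofReal r < z.1}, ?_, powerMeasure_Ioi_lt_top α ?_⟩
      · exact (isOpen_Ioi.preimage continuous_subtype_val).mem_nhds hr.2
      · exact ENNReal.ofReal_pos.1 hr.1
    infer_instance⟩

/-- The scaling function `b(x) = (Γ(3 + 2δ) / Γ(1 + δ)) ^ (1 / (2 + δ)) x ^ (1 / (2 + δ))`. -/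
def scaleB (δ x : ℝ) : ℝ :=
  (Real.Gamma (3 + 2 * δ) / Real.Gamma (1 + δ)) ^ (1 / (2 + δ)) * x ^ (1 / (2 + δ))

end

/-!
In `G(n)` the number of vertices of degree greater than `m` is close to `n` times a limiting tail
weight. The weights satisfy the stationary form of the recursion for the conditional mean of these
counts, and the convexity of the square turns one attachment step into a bound on the second moment
of the deviation: it grows by at most `1`, so it is at most `n`, uniformly in `m`. Since
`√n = o(k)`, the counts divided by `k` therefore concentrate at levels `y b(n / k)`, where the tail
weights are asymptotic to `y ^ (-(2 + δ)) k / n` by Euler's limit formula for the Gamma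
function. The order statistics are obtained by inverting this monotone limit, and the empirical
measure by inserting `D_(k)` in place of `b(n / k)`; on `(0, ∞]` convergence of the measures of all
sets `(x, ∞]` implies vague convergence.
-/

open scoped Finset

/-! ## The limiting degree distribution -/

/-- The limiting proportion of vertices of degree greater than `m`. -/
noncomputable def tailWeight (δ : ℝ) (m : ℕ) : ℝ :=
  ∏ j ∈ Finset.range m, (1 + δ + j) / (3 + 2 * δ + j)

@[simp]
theorem tailWeight_zero (δ : ℝ) : tailWeight δ 0 = 1 := by simp [tailWeight]

theorem tailWeight_succ (δ : ℝ) (m : ℕ) :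
    tailWeight δ (m + 1) = tailWeight δ m * ((1 + δ + m) / (3 + 2 * δ + m)) :=
  Finset.prod_range_succ ..

section

variable {δ : ℝ} (hδ : -1 < δ)
include hδ

theorem tailWeight_nonneg (m : ℕ) : 0 ≤ tailWeight δ m :=
  Finset.prod_nonneg fun j _ => div_nonneg
    (by linarith [j.cast_nonneg (α := ℝ)]) (by linarith [j.cast_nonneg (α := ℝ)])

theorem tailWeight_recurrence (m : ℕ) :
    (1 + δ + m) * (tailWeight δ m - tailWeight δ (m + 1)) = (2 + δ) * tailWeight δ (m + 1) := by
  have hden : 3 + 2 * δ + m ≠ 0 := by linarith [m.cast_nonneg (α := ℝ)]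
  have hsucc : tailWeight δ (m + 1) * (3 + 2 * δ + m) = tailWeight δ m * (1 + δ + m) := by
    rw [tailWeight_succ, mul_assoc, div_mul_cancel₀ _ hden]
  linear_combination -hsucc

theorem succ_mul_tailWeight_le_one (m : ℕ) : (m + 1) * tailWeight δ m ≤ 1 := by
  induction m with
  | zero => simp
  | succ m ih =>
    have hfactor : ((m : ℝ) + 2) * ((1 + δ + m) / (3 + 2 * δ + m)) ≤ m + 1 := by
      rw [← mul_div_assoc, div_le_iff₀ (by linarith [m.cast_nonneg (α := ℝ)])]
      nlinarith
    calc ((m + 1 : ℕ) + 1) * tailWeight δ (m + 1)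
        = ((m : ℝ) + 2) * ((1 + δ + m) / (3 + 2 * δ + m)) * tailWeight δ m := by
          rw [tailWeight_succ]; push_cast; ring
      _ ≤ (m + 1) * tailWeight δ m := by gcongr; exact tailWeight_nonneg hδ m
      _ ≤ 1 := ih

theorem tailWeight_succ_eq_gammaSeq {n : ℕ} (hn : n ≠ 0) :
    tailWeight δ (n + 1) =
      (n : ℝ) ^ (-(2 + δ)) * (Real.GammaSeq (3 + 2 * δ) n / Real.GammaSeq (1 + δ) n) := by
  have hn' : (0 : ℝ) < n := by positivity
  have hnum : ∏ j ∈ Finset.range (n + 1), (1 + δ + j) ≠ 0 :=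
    Finset.prod_ne_zero_iff.2 fun j _ => by linarith [j.cast_nonneg (α := ℝ)]
  have hpow : (n : ℝ) ^ (3 + 2 * δ) = (n : ℝ) ^ (1 + δ) * (n : ℝ) ^ (2 + δ) := by
    rw [← Real.rpow_add hn']
    ring_nf
  rw [tailWeight, Finset.prod_div_distrib, Real.GammaSeq, Real.GammaSeq, hpow,
    Real.rpow_neg hn'.le]
  field_simp

theorem Gamma_div_Gamma_pos : 0 < Real.Gamma (3 + 2 * δ) / Real.Gamma (1 + δ) :=
  div_pos (Real.Gamma_pos_of_pos (by linarith)) (Real.Gamma_pos_of_pos (by linarith))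

theorem tendsto_rpow_mul_tailWeight :
    Tendsto (fun m : ℕ => (m : ℝ) ^ (2 + δ) * tailWeight δ m) atTop
      (𝓝 (Real.Gamma (3 + 2 * δ) / Real.Gamma (1 + δ))) := by
  rw [← tendsto_add_atTop_iff_nat 1]
  have hratio := ((Real.GammaSeq_tendsto_Gamma (3 + 2 * δ)).div
    (Real.GammaSeq_tendsto_Gamma (1 + δ)) (Real.Gamma_pos_of_pos (by linarith)).ne')
  have hshift : Tendsto (fun n : ℕ => ((n : ℝ) / (n + 1)) ^ (-(2 + δ))) atTop (𝓝 1) := by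
    simpa using (tendsto_natCast_div_add_atTop (1 : ℝ)).rpow_const (p := -(2 + δ))
      (Or.inl one_ne_zero)
  have hmul := hshift.mul hratio
  rw [one_mul] at hmul
  refine hmul.congr' ?_
  filter_upwards [eventually_ne_atTop 0] with n hn
  rw [tailWeight_succ_eq_gammaSeq hδ hn, Real.div_rpow (by positivity) (by positivity),
    Real.rpow_neg (by positivity : (0 : ℝ) ≤ n + 1), div_inv_eq_mul, Pi.div_apply]
  push_cast
  ring

theorem scaleB_rpow {x : ℝ} (hx : 0 ≤ x) :
    scaleB δ x ^ (2 + δ) = Real.Gamma (3 + 2 * δ) / Real.Gamma (1 + δ) * x := by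
  have hc := (Gamma_div_Gamma_pos hδ).le
  rw [scaleB, ← Real.mul_rpow hc hx, one_div, Real.rpow_inv_rpow (by positivity) (by linarith)]

theorem scaleB_pos {x : ℝ} (hx : 0 < x) : 0 < scaleB δ x :=
  mul_pos (Real.rpow_pos_of_pos (Gamma_div_Gamma_pos hδ) _) (Real.rpow_pos_of_pos hx _)

theorem tendsto_scaleB : Tendsto (scaleB δ) atTop atTop :=
  (tendsto_rpow_atTop (one_div_pos.2 (by linarith))).const_mul_atTop
    (Real.rpow_pos_of_pos (Gamma_div_Gamma_pos hδ) _)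

theorem tendsto_mul_tailWeight_floor_mul_scaleB {y : ℝ} (hy : 0 < y) :
    Tendsto (fun u => u * tailWeight δ ⌊y * scaleB δ u⌋₊) atTop (𝓝 (y ^ (-(2 + δ)))) := by
  have hc := Gamma_div_Gamma_pos hδ
  have hlevel : Tendsto (fun u => ⌊y * scaleB δ u⌋₊) atTop atTop :=
    tendsto_nat_floor_atTop.comp ((tendsto_scaleB hδ).const_mul_atTop hy)
  have hratio := ((tendsto_nat_floor_mul_div_atTop hy.le).comp (tendsto_scaleB hδ)).rpow_const
    (p := -(2 + δ)) (Or.inl hy.ne')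
  have hmul := hratio.mul (((tendsto_rpow_mul_tailWeight hδ).comp hlevel).div_const
    (Real.Gamma (3 + 2 * δ) / Real.Gamma (1 + δ)))
  rw [div_self hc.ne', mul_one] at hmul
  refine hmul.congr' ?_
  filter_upwards [eventually_gt_atTop 0, hlevel.eventually_gt_atTop 0] with u hu hm
  have : (0 : ℝ) < (⌊y * scaleB δ u⌋₊ : ℝ) ^ (2 + δ) := by positivity
  obtain ⟨hnum, hden⟩ := div_ne_zero_iff.1 hc.ne'
  simp only [Function.comp_apply]
  rw [Real.rpow_neg (by have := scaleB_pos hδ hu; positivity),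
    Real.div_rpow (by positivity) (scaleB_pos hδ hu).le, scaleB_rpow hδ hu.le]
  field_simp

end

/-! ## One attachment step -/

theorem sum_mul_add_ite_sq_le {ι : Type*} {s : Finset ι} {p : ι → ℝ} (hp : ∑ i ∈ s, p i = 1)
    (q : ι → Prop) [DecidablePred q] (c : ℝ) :
    ∑ i ∈ s, p i * (c + if q i then 1 else 0) ^ 2 ≤ (c + ∑ i ∈ s with q i, p i) ^ 2 + 1 / 4 := by
  set A := ∑ i ∈ s with q i, p i with hA
  have hexpand : ∑ i ∈ s, p i * (c + if q i then 1 else 0) ^ 2 = c ^ 2 + A * (2 * c + 1) := by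
    have hc : c ^ 2 = ∑ i ∈ s, p i * c ^ 2 := by rw [← Finset.sum_mul, hp, one_mul]
    rw [hc, hA, Finset.sum_filter, Finset.sum_mul, ← Finset.sum_add_distrib]
    refine Finset.sum_congr rfl fun i _ => ?_
    split_ifs <;> ring
  linarith [sq_nonneg (A - 1 / 2)]

theorem sq_convexCombo_le {a : ℝ} (ha₀ : 0 ≤ a) (ha₁ : a ≤ 1) (y z : ℝ) :
    ((1 - a) * y + a * z) ^ 2 ≤ (1 - a) * y ^ 2 + a * z ^ 2 := by
  simpa using (even_two.convexOn_pow (𝕜 := ℝ)).2 (mem_univ y) (mem_univ z) (sub_nonneg.2 ha₁) ha₀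
    (sub_add_cancel 1 a)

/-- The probability that the vertex added at time `n + 1` is attached to a given vertex of degree
`d`. -/
noncomputable def attachProb (δ : ℝ) (n d : ℕ) : ℝ :=
  (d + δ) / ((2 + δ) * n)

theorem attachProb_nonneg {δ : ℝ} (hδ : -1 < δ) (n : ℕ) {d : ℕ} (hd : 1 ≤ d) :
    0 ≤ attachProb δ n d := by
  have hd' : (1 : ℝ) ≤ d := by exact_mod_cast hd
  exact div_nonneg (by linarith) (mul_nonneg (by linarith) n.cast_nonneg)

theorem attachProb_le_one {δ : ℝ} (hδ : -1 < δ) {n d : ℕ} (hn : 1 ≤ n) (hd : d ≤ n + 1) :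
    attachProb δ n d ≤ 1 := by
  have hn' : (1 : ℝ) ≤ n := by exact_mod_cast hn
  have hd' : (d : ℝ) ≤ n + 1 := by exact_mod_cast hd
  rw [attachProb, div_le_one (by nlinarith)]
  nlinarith

namespace LabelledMultigraph

theorem degree_cons (a b : ℕ) (g : LabelledMultigraph) (j : ℕ) :
    LabelledMultigraph.degree (s(a, b) ::ₘ g) j =
      (if j = a then 1 else 0) + (if j = b then 1 else 0) + g.degree j := by
  have hedge : s(a, b).toMultiset = {a, b} := rfl
  simp only [degree, Multiset.map_cons, Multiset.sum_cons, hedge, Multiset.insert_eq_cons,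
    Multiset.count_cons, Multiset.count_singleton]
  ring

theorem degree_singleton (a b j : ℕ) :
    LabelledMultigraph.degree {s(a, b)} j = (if j = a then 1 else 0) + if j = b then 1 else 0 :=
  degree_cons a b 0 j

/-- The number of vertices among `1, …, n` whose degree exceeds `z`. The threshold is real because
the scaled degrees `D_i / b` are compared with arbitrary levels. -/
noncomputable def exceedanceCount (g : LabelledMultigraph) (n : ℕ) (z : ℝ) : ℕ :=
  #{i ∈ Finset.Icc 1 n | z < g.degree i}

theorem exceedanceCount_le (g : LabelledMultigraph) (n : ℕ) (z : ℝ) :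
    g.exceedanceCount n z ≤ n :=
  (Finset.card_filter_le _ _).trans_eq (by simp)

theorem exceedanceCount_antitone (g : LabelledMultigraph) (n : ℕ) :
    Antitone (g.exceedanceCount n) := fun _ _ hle =>
  Finset.card_le_card (Finset.monotone_filter_right _ fun _ _ hlt => hle.trans_lt hlt)

theorem exceedanceCount_natFloor (g : LabelledMultigraph) (n : ℕ) {z : ℝ} (hz : 0 ≤ z) :
    g.exceedanceCount n ⌊z⌋₊ = g.exceedanceCount n z := by
  simp only [exceedanceCount, Nat.cast_lt, Nat.floor_lt hz]

theorem card_degree_eq_add_exceedanceCount (g : LabelledMultigraph) (n m : ℕ) :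
    #{i ∈ Finset.Icc 1 n | g.degree i = m + 1} + g.exceedanceCount n (m + 1 : ℕ) =
      g.exceedanceCount n m := by
  simp only [exceedanceCount, Nat.cast_lt, Finset.card_filter, ← Finset.sum_add_distrib]
  exact Finset.sum_congr rfl fun i _ => by split_ifs <;> omega

theorem sum_attachProb_degree_eq (g : LabelledMultigraph) (δ : ℝ) (n m : ℕ) :
    ∑ i ∈ Finset.Icc 1 n with g.degree i = m + 1, attachProb δ n (g.degree i) =
      attachProb δ n (m + 1) * (g.exceedanceCount n m - g.exceedanceCount n (m + 1 : ℕ)) := by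
  have hprob : ∀ i ∈ {i ∈ Finset.Icc 1 n | g.degree i = m + 1},
      attachProb δ n (g.degree i) = attachProb δ n (m + 1) := fun i hi => by
    rw [(Finset.mem_filter.1 hi).2]
  rw [Finset.sum_congr rfl hprob, Finset.sum_const, nsmul_eq_mul,
    ← card_degree_eq_add_exceedanceCount g n m]
  push_cast
  ring

/-- The graphs on the vertices `1, …, n` that the attachment process can reach at time `n`. -/
inductive IsRecursiveTree : ℕ → LabelledMultigraph → Prop
  | one : IsRecursiveTree 1 {s(1, 1)}
  | cons {n : ℕ} {g : LabelledMultigraph} {i : ℕ} (hg : IsRecursiveTree n g)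
      (hi : i ∈ Finset.Icc 1 n) : IsRecursiveTree (n + 1) (s(n + 1, i) ::ₘ g)

/-- The deviation of the number of vertices of degree greater than `m` from its asymptotic
mean. -/
noncomputable def tailDeviation (δ : ℝ) (n m : ℕ) (g : LabelledMultigraph) : ℝ :=
  g.exceedanceCount n m - n * tailWeight δ m

theorem sq_tailDeviation_le {δ : ℝ} (hδ : -1 < δ) (n m : ℕ) (g : LabelledMultigraph) :
    tailDeviation δ n m g ^ 2 ≤ (n : ℝ) ^ 2 := by
  have hcount : (g.exceedanceCount n m : ℝ) ≤ n := by exact_mod_cast g.exceedanceCount_le n m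
  have hw₀ := tailWeight_nonneg hδ m
  have hw₁ : tailWeight δ m ≤ 1 := by
    have := succ_mul_tailWeight_le_one hδ m
    nlinarith
  refine sq_le_sq' ?_ ?_ <;> rw [tailDeviation] <;> nlinarith

namespace IsRecursiveTree

variable {n : ℕ} {g : LabelledMultigraph}

theorem one_le (hg : IsRecursiveTree n g) : 1 ≤ n := by
  cases hg <;> omega

theorem degree_eq_zero (hg : IsRecursiveTree n g) {j : ℕ} (hj : n < j) : g.degree j = 0 := by
  induction hg with
  | one => rw [degree_singleton, if_neg hj.ne']
  | cons _ hi ih =>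
    rw [degree_cons, ih (by omega), if_neg hj.ne', if_neg (by grind)]

theorem one_le_degree (hg : IsRecursiveTree n g) {j : ℕ} (hj : j ∈ Finset.Icc 1 n) :
    1 ≤ g.degree j := by
  induction hg with
  | one => simp_all [degree_singleton]
  | @cons n g i _ _ ih =>
    rw [degree_cons]
    rcases eq_or_ne j (n + 1) with rfl | hne
    · rw [if_pos rfl]
      omega
    · have := ih (by grind)
      omega

theorem sum_degree (hg : IsRecursiveTree n g) : ∑ j ∈ Finset.Icc 1 n, g.degree j = 2 * n := by
  induction hg with
  | one => simp [degree_singleton]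
  | @cons n g i hg hi ih =>
    have hi' : i ∈ Finset.Icc 1 (n + 1) := by grind
    simp only [degree_cons, Finset.sum_add_distrib, Finset.sum_ite_eq', hi',
      Finset.sum_Icc_succ_top (Nat.le_add_left 1 n) g.degree, ih, hg.degree_eq_zero n.lt_succ_self]
    simp only [Finset.mem_Icc, le_add_iff_nonneg_left, zero_le, le_refl, and_self, if_true,
      Nat.reduceAdd, add_zero]
    ring

theorem degree_le (hg : IsRecursiveTree n g) {j : ℕ} (hj : j ∈ Finset.Icc 1 n) :
    g.degree j ≤ n + 1 := by
  have hothers : #((Finset.Icc 1 n).erase j) • 1 ≤ ∑ l ∈ (Finset.Icc 1 n).erase j, g.degree l :=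
    Finset.card_nsmul_le_sum _ _ _ fun l hl => hg.one_le_degree (Finset.mem_of_mem_erase hl)
  have htotal := (Finset.add_sum_erase _ g.degree hj).trans hg.sum_degree
  rw [Finset.card_erase_of_mem hj, Nat.card_Icc, smul_eq_mul] at hothers
  omega

theorem exceedanceCount_zero (hg : IsRecursiveTree n g) : g.exceedanceCount n 0 = n := by
  rw [exceedanceCount, Finset.filter_true_of_mem, Nat.card_Icc, Nat.add_sub_cancel]
  exact fun j hj => by exact_mod_cast hg.one_le_degree hj

theorem exceedanceCount_eq_zero (hg : IsRecursiveTree n g) {m : ℕ} (hm : n < m) :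
    g.exceedanceCount n m = 0 := by
  rw [exceedanceCount, Finset.card_eq_zero, Finset.filter_eq_empty_iff]
  intro j hj
  exact_mod_cast ((hg.degree_le hj).trans hm).not_gt

theorem exceedanceCount_cons (hg : IsRecursiveTree n g) {i : ℕ} (hi : i ∈ Finset.Icc 1 n)
    (m : ℕ) :
    LabelledMultigraph.exceedanceCount (s(n + 1, i) ::ₘ g) (n + 1) (m + 1 : ℕ) =
      g.exceedanceCount n (m + 1 : ℕ) + if g.degree i = m + 1 then 1 else 0 := by
  have hnew : ¬ m + 1 < LabelledMultigraph.degree (s(n + 1, i) ::ₘ g) (n + 1) := by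
    have := Finset.mem_Icc.1 hi
    rw [degree_cons, hg.degree_eq_zero n.lt_succ_self, if_pos rfl, if_neg (by omega)]
    omega
  have hite : (if g.degree i = m + 1 then 1 else 0) =
      ∑ j ∈ Finset.Icc 1 n, if j = i then (if g.degree j = m + 1 then 1 else 0) else 0 := by
    rw [Finset.sum_ite_eq', if_pos hi]
  simp only [exceedanceCount, Nat.cast_lt, Finset.card_filter]
  rw [Finset.sum_Icc_succ_top (by omega), if_neg hnew, add_zero, hite, ← Finset.sum_add_distrib]
  refine Finset.sum_congr rfl fun j hj => ?_
  rw [degree_cons, if_neg (by grind : j ≠ n + 1)]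
  split_ifs <;> omega

variable {δ : ℝ}

theorem sum_degree_add (hg : IsRecursiveTree n g) (δ : ℝ) :
    ∑ j ∈ Finset.Icc 1 n, ((g.degree j : ℝ) + δ) = (2 + δ) * n := by
  rw [Finset.sum_add_distrib, ← Nat.cast_sum, hg.sum_degree, Finset.sum_const, Nat.card_Icc,
    nsmul_eq_mul, Nat.add_sub_cancel]
  push_cast
  ring

theorem tailDeviation_zero (hg : IsRecursiveTree n g) : tailDeviation δ n 0 g = 0 := by
  simp [tailDeviation, hg.exceedanceCount_zero]

variable (hδ : -1 < δ)
include hδ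

theorem sum_attachProb (hg : IsRecursiveTree n g) :
    ∑ i ∈ Finset.Icc 1 n, attachProb δ n (g.degree i) = 1 := by
  have hn : (n : ℝ) ≠ 0 := by exact_mod_cast Nat.ne_of_gt hg.one_le
  simp only [attachProb]
  rw [← Finset.sum_div, hg.sum_degree_add, div_self (mul_ne_zero (by linarith) hn)]

theorem sq_tailDeviation_le_one (hg : IsRecursiveTree n g) {m : ℕ} (hm : n < m) :
    tailDeviation δ n m g ^ 2 ≤ 1 := by
  have hnonneg := mul_nonneg n.cast_nonneg (tailWeight_nonneg hδ m)
  rw [tailDeviation, hg.exceedanceCount_eq_zero hm, Nat.cast_zero, zero_sub, neg_sq]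
  refine pow_le_one₀ hnonneg (le_trans ?_ (succ_mul_tailWeight_le_one hδ m))
  have hnm : (n : ℝ) ≤ m := by exact_mod_cast hm.le
  have := tailWeight_nonneg hδ m
  gcongr
  linarith

theorem tailDeviation_cons_mean (hg : IsRecursiveTree n g) (m : ℕ) :
    g.exceedanceCount n (m + 1 : ℕ) - (n + 1) * tailWeight δ (m + 1) +
        ∑ i ∈ Finset.Icc 1 n with g.degree i = m + 1, attachProb δ n (g.degree i) =
      (1 - attachProb δ n (m + 1)) * tailDeviation δ n (m + 1) g +
        attachProb δ n (m + 1) * tailDeviation δ n m g := by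
  have hn : (n : ℝ) ≠ 0 := by exact_mod_cast Nat.ne_of_gt hg.one_le
  have hδ' : 2 + δ ≠ 0 := by linarith
  have hweight : attachProb δ n (m + 1) * n * (tailWeight δ m - tailWeight δ (m + 1)) =
      tailWeight δ (m + 1) := by
    rw [attachProb, ← mul_right_inj' hδ', ← tailWeight_recurrence hδ m]
    push_cast
    field_simp
    ring
  rw [sum_attachProb_degree_eq, tailDeviation, tailDeviation]
  linear_combination hweight

/-- The mean of the new deviation at level `m + 1` is a convex combination of the old deviations at
levels `m` and `m + 1`, and the indicator of a degree increment has variance at most `1 / 4`. -/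
theorem sum_attachProb_mul_sq_tailDeviation_cons_le (hg : IsRecursiveTree n g) {m : ℕ}
    (hmn : m ≤ n) :
    ∑ i ∈ Finset.Icc 1 n,
        attachProb δ n (g.degree i) * tailDeviation δ (n + 1) (m + 1) (s(n + 1, i) ::ₘ g) ^ 2 ≤
      (1 - attachProb δ n (m + 1)) * tailDeviation δ n (m + 1) g ^ 2 +
        attachProb δ n (m + 1) * tailDeviation δ n m g ^ 2 + 1 / 4 := by
  set c : ℝ := g.exceedanceCount n (m + 1 : ℕ) - (n + 1) * tailWeight δ (m + 1) with hc
  calc ∑ i ∈ Finset.Icc 1 n,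
        attachProb δ n (g.degree i) * tailDeviation δ (n + 1) (m + 1) (s(n + 1, i) ::ₘ g) ^ 2
      = ∑ i ∈ Finset.Icc 1 n,
          attachProb δ n (g.degree i) * (c + if g.degree i = m + 1 then 1 else 0) ^ 2 := by
        refine Finset.sum_congr rfl fun i hi => ?_
        rw [tailDeviation, hg.exceedanceCount_cons hi, hc]
        push_cast
        ring
    _ ≤ (c + ∑ i ∈ Finset.Icc 1 n with g.degree i = m + 1,
          attachProb δ n (g.degree i)) ^ 2 + 1 / 4 :=
        sum_mul_add_ite_sq_le (hg.sum_attachProb hδ) _ c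
    _ ≤ _ := by
        rw [hc, hg.tailDeviation_cons_mean hδ]
        gcongr
        exact sq_convexCombo_le (attachProb_nonneg hδ n (by omega))
          (attachProb_le_one hδ hg.one_le (by omega)) _ _

end IsRecursiveTree
end LabelledMultigraph

/-! ## The second moment of the degree counts -/

theorem lintegral_eq_tsum_setLIntegral_fiber {Ω α : Type*} [MeasurableSpace Ω] [MeasurableSpace α]
    [MeasurableSingletonClass α] [Countable α] {X : Ω → α} (hX : Measurable X) (P : Measure Ω)
    (f : Ω → ℝ≥0∞) : ∫⁻ ω, f ω ∂P = ∑' a, ∫⁻ ω in X ⁻¹' {a}, f ω ∂P := by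
  rw [← lintegral_iUnion (fun a => hX (measurableSet_singleton a))
    (pairwise_disjoint_fiber X), ← preimage_iUnion, iUnion_of_singleton, preimage_univ,
    Measure.restrict_univ]

theorem lintegral_eq_sum_of_measure_finset_eq_one {α : Type*} [MeasurableSpace α]
    [MeasurableSingletonClass α] {μ : Measure α} [IsProbabilityMeasure μ] {s : Finset α}
    (hs : μ s = 1) (φ : α → ℝ≥0∞) : ∫⁻ a, φ a ∂μ = ∑ a ∈ s, φ a * μ {a} := by
  rw [← lintegral_finset, Measure.restrict_eq_self_of_ae_mem (s := (s : Set α))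
    ((mem_ae_iff_prob_eq_one s.measurableSet).2 hs)]

namespace LabelledMultigraph

instance : MeasurableSpace LabelledMultigraph := ⊤

instance : DiscreteMeasurableSpace LabelledMultigraph := ⟨fun _ => trivial⟩

theorem injective_cons_edge (n : ℕ) (g : LabelledMultigraph) :
    Function.Injective fun i => (s(n, i) ::ₘ g : LabelledMultigraph) := fun _ _ heq =>
  Sym2.congr_right.1 ((Multiset.cons_inj_left g).1 heq)

end LabelledMultigraph

namespace IsPreferentialAttachmentA

open LabelledMultigraph

variable {Ω : Type*} [MeasurableSpace Ω] {P : Measure Ω} {δ : ℝ}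
  {G : ℕ → Ω → LabelledMultigraph} {n : ℕ}

theorem measurable (hG : IsPreferentialAttachmentA P δ G) (hn : 1 ≤ n) : Measurable (G n) :=
  measurable_to_countable' fun g => hG.measurableSet_eq n hn g

theorem cond_eq_cons (hG : IsPreferentialAttachmentA P δ G) {g : LabelledMultigraph}
    (hg : IsRecursiveTree n g) (hP : P {ω | G n ω = g} ≠ 0) {i : ℕ} (hi : i ∈ Finset.Icc 1 n) :
    P[|{ω | G n ω = g}] {ω | G (n + 1) ω = s(n + 1, i) ::ₘ g} =
      ENNReal.ofReal (attachProb δ n (g.degree i)) := by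
  rw [attachProb, ← hg.sum_degree_add, ← hG.step n hg.one_le g hP i hi, ofReal_measureReal]

variable [IsProbabilityMeasure P] (hδ : -1 < δ)
include hδ

theorem lintegral_cond_succ (hG : IsPreferentialAttachmentA P δ G) {g : LabelledMultigraph}
    (hg : IsRecursiveTree n g) (hP : P {ω | G n ω = g} ≠ 0) (φ : LabelledMultigraph → ℝ≥0∞) :
    ∫⁻ ω, φ (G (n + 1) ω) ∂P[|{ω | G n ω = g}] =
      ∑ i ∈ Finset.Icc 1 n,
        ENNReal.ofReal (attachProb δ n (g.degree i)) * φ (s(n + 1, i) ::ₘ g) := by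
  have hsucc : Measurable (G (n + 1)) := hG.measurable (Nat.le_add_left 1 n)
  have : IsProbabilityMeasure P[|{ω | G n ω = g}] := cond_isProbabilityMeasure hP
  have : IsProbabilityMeasure ((P[|{ω | G n ω = g}]).map (G (n + 1))) :=
    Measure.isProbabilityMeasure_map hsucc.aemeasurable
  have hlaw : ∀ i ∈ Finset.Icc 1 n, (P[|{ω | G n ω = g}]).map (G (n + 1)) {s(n + 1, i) ::ₘ g} =
      ENNReal.ofReal (attachProb δ n (g.degree i)) := fun i hi => by
    rw [Measure.map_apply hsucc (measurableSet_singleton _)]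
    exact hG.cond_eq_cons hg hP hi
  rw [← lintegral_map (Measurable.of_discrete (f := φ)) hsucc,
    lintegral_eq_sum_of_measure_finset_eq_one
      (s := (Finset.Icc 1 n).map ⟨_, injective_cons_edge (n + 1) g⟩), Finset.sum_map]
  · exact Finset.sum_congr rfl fun i hi => by
      rw [mul_comm, Function.Embedding.coeFn_mk, hlaw i hi]
  · rw [← sum_measure_singleton, Finset.sum_map]
    simp only [Function.Embedding.coeFn_mk]
    rw [Finset.sum_congr rfl hlaw, ← ENNReal.ofReal_sum_of_nonneg fun i hi =>
      attachProb_nonneg hδ n (hg.one_le_degree hi), hg.sum_attachProb hδ, ENNReal.ofReal_one]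

theorem lintegral_succ_of_ae (hG : IsPreferentialAttachmentA P δ G) (hn : 1 ≤ n)
    (htree : ∀ᵐ ω ∂P, IsRecursiveTree n (G n ω)) (φ : LabelledMultigraph → ℝ≥0∞) :
    ∫⁻ ω, φ (G (n + 1) ω) ∂P = ∫⁻ ω, ∑ i ∈ Finset.Icc 1 n,
      ENNReal.ofReal (attachProb δ n ((G n ω).degree i)) * φ (s(n + 1, i) ::ₘ G n ω) ∂P := by
  have hfiber (g : LabelledMultigraph) : MeasurableSet (G n ⁻¹' {g}) :=
    hG.measurable hn (measurableSet_singleton g)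
  rw [lintegral_eq_tsum_setLIntegral_fiber (hG.measurable hn),
    lintegral_eq_tsum_setLIntegral_fiber (hG.measurable hn) P fun ω => ∑ i ∈ Finset.Icc 1 n, _]
  refine tsum_congr fun g => ?_
  rcases eq_or_ne (P (G n ⁻¹' {g})) 0 with hP | hP
  · simp only [Measure.restrict_eq_zero.2 hP, lintegral_zero_measure]
  obtain ⟨ω, rfl, hg⟩ : ∃ ω, G n ω = g ∧ IsRecursiveTree n (G n ω) :=
    ((frequently_ae_mem_iff.2 hP).and_eventually htree).exists
  calc ∫⁻ ω' in G n ⁻¹' {G n ω}, φ (G (n + 1) ω') ∂P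
      = P (G n ⁻¹' {G n ω}) * ∫⁻ ω', φ (G (n + 1) ω') ∂P[|{ω' | G n ω' = G n ω}] := by
        have hcond : P[|{ω' | G n ω' = G n ω}] =
            (P (G n ⁻¹' {G n ω}))⁻¹ • P.restrict (G n ⁻¹' {G n ω}) := rfl
        rw [hcond, lintegral_smul_measure, smul_eq_mul, ← mul_assoc,
          ENNReal.mul_inv_cancel hP (measure_ne_top P _), one_mul]
    _ = _ := by
        rw [hG.lintegral_cond_succ hδ hg hP, mul_comm, ← setLIntegral_const]
        exact setLIntegral_congr_fun (hfiber _) fun ω' hω' => by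
          rw [show G n ω' = G n ω from hω']

theorem ae_isRecursiveTree (hG : IsPreferentialAttachmentA P δ G) (hn : 1 ≤ n) :
    ∀ᵐ ω ∂P, IsRecursiveTree n (G n ω) := by
  induction n, hn using Nat.le_induction with
  | base => exact hG.init.mono fun ω hω => hω ▸ .one
  | succ n hn ih =>
    let φ : LabelledMultigraph → ℝ≥0∞ := {g | ¬ IsRecursiveTree (n + 1) g}.indicator 1
    have hmeas : Measurable fun ω => φ (G (n + 1) ω) :=
      (Measurable.of_discrete (f := φ)).comp (hG.measurable (Nat.le_add_left 1 n))
    have hzero : ∫⁻ ω, φ (G (n + 1) ω) ∂P = 0 := by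
      rw [hG.lintegral_succ_of_ae hδ hn ih]
      refine (lintegral_congr_ae (ih.mono fun ω hω => Finset.sum_eq_zero fun i hi => ?_)).trans
        lintegral_zero
      rw [show φ _ = 0 from indicator_of_notMem (not_not.2 (hω.cons hi)) 1, mul_zero]
    filter_upwards [(lintegral_eq_zero_iff hmeas).1 hzero] with ω hω
    by_contra hnot
    simp [φ, hnot] at hω

theorem lintegral_succ (hG : IsPreferentialAttachmentA P δ G) (hn : 1 ≤ n)
    (φ : LabelledMultigraph → ℝ≥0∞) :
    ∫⁻ ω, φ (G (n + 1) ω) ∂P = ∫⁻ ω, ∑ i ∈ Finset.Icc 1 n,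
      ENNReal.ofReal (attachProb δ n ((G n ω).degree i)) * φ (s(n + 1, i) ::ₘ G n ω) ∂P :=
  hG.lintegral_succ_of_ae hδ hn (hG.ae_isRecursiveTree hδ hn) φ

theorem lintegral_sq_tailDeviation_succ_le (hG : IsPreferentialAttachmentA P δ G) (hn : 1 ≤ n)
    {m : ℕ} (hmn : m ≤ n) :
    ∫⁻ ω, ENNReal.ofReal (tailDeviation δ (n + 1) (m + 1) (G (n + 1) ω) ^ 2) ∂P ≤
      ENNReal.ofReal (1 - attachProb δ n (m + 1)) *
          ∫⁻ ω, ENNReal.ofReal (tailDeviation δ n (m + 1) (G n ω) ^ 2) ∂P +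
        ENNReal.ofReal (attachProb δ n (m + 1)) *
          ∫⁻ ω, ENNReal.ofReal (tailDeviation δ n m (G n ω) ^ 2) ∂P + 1 := by
  have hmeas (ψ : LabelledMultigraph → ℝ≥0∞) : Measurable fun ω => ψ (G n ω) :=
    Measurable.of_discrete.comp (hG.measurable hn)
  have ha₀ := attachProb_nonneg hδ n (Nat.le_add_left 1 m)
  have ha₁ := sub_nonneg.2 (attachProb_le_one hδ hn (Nat.succ_le_succ hmn))
  have hone : ∫⁻ _, 1 ∂P = 1 := by rw [lintegral_one, measure_univ]
  rw [hG.lintegral_succ hδ hn fun g => ENNReal.ofReal (tailDeviation δ (n + 1) (m + 1) g ^ 2),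
    ← lintegral_const_mul _ (hmeas fun g => ENNReal.ofReal (tailDeviation δ n (m + 1) g ^ 2)),
    ← lintegral_const_mul _ (hmeas fun g => ENNReal.ofReal (tailDeviation δ n m g ^ 2)),
    ← lintegral_add_left (hmeas fun g => _ * ENNReal.ofReal (tailDeviation δ n (m + 1) g ^ 2)),
    ← hone, ← lintegral_add_right _ measurable_const]
  refine lintegral_mono_ae ((hG.ae_isRecursiveTree hδ hn).mono fun ω hω => ?_)
  have hterm : ∀ i ∈ Finset.Icc 1 n, 0 ≤ attachProb δ n ((G n ω).degree i) := fun i hi =>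
    attachProb_nonneg hδ n (hω.one_le_degree hi)
  rw [← ENNReal.ofReal_mul ha₀, ← ENNReal.ofReal_mul ha₁, ← ENNReal.ofReal_add (by positivity)
    (by positivity), ← ENNReal.ofReal_one, ← ENNReal.ofReal_add (by positivity) one_pos.le,
    Finset.sum_congr rfl fun i hi => (ENNReal.ofReal_mul (hterm i hi)).symm,
    ← ENNReal.ofReal_sum_of_nonneg fun i hi => mul_nonneg (hterm i hi) (sq_nonneg _)]
  exact ENNReal.ofReal_le_ofReal
    ((hω.sum_attachProb_mul_sq_tailDeviation_cons_le hδ hmn).trans (by linarith))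

theorem lintegral_sq_tailDeviation_le (hG : IsPreferentialAttachmentA P δ G) (hn : 1 ≤ n)
    (m : ℕ) : ∫⁻ ω, ENNReal.ofReal (tailDeviation δ n m (G n ω) ^ 2) ∂P ≤ n := by
  induction n, hn using Nat.le_induction generalizing m with
  | base =>
    refine (lintegral_mono fun ω => ENNReal.ofReal_le_one.2 ?_).trans_eq
      (by rw [lintegral_one, measure_univ, Nat.cast_one])
    simpa using sq_tailDeviation_le hδ 1 m (G 1 ω)
  | succ n hn ih =>
    rcases le_or_gt m (n + 1) with hmn | hnm
    · rcases m with _ | m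
      · refine (lintegral_mono_ae (g := 0) ?_).trans (by simp)
        filter_upwards [hG.ae_isRecursiveTree hδ (Nat.le_add_left 1 n)] with ω hω
        simp [hω.tailDeviation_zero]
      · have hmn' := Nat.le_of_succ_le_succ hmn
        have ha₀ := attachProb_nonneg hδ n (Nat.le_add_left 1 m)
        have ha₁ := sub_nonneg.2 (attachProb_le_one hδ hn hmn)
        refine (hG.lintegral_sq_tailDeviation_succ_le hδ hn hmn').trans ?_
        grw [ih, ih, ← add_mul, ← ENNReal.ofReal_add ha₁ ha₀, sub_add_cancel, ENNReal.ofReal_one,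
          one_mul, Nat.cast_succ]
    · refine (lintegral_mono_ae (g := 1) ?_).trans (by simp)
      filter_upwards [hG.ae_isRecursiveTree hδ (Nat.le_add_left 1 n)] with ω hω
      exact ENNReal.ofReal_le_one.2 (hω.sq_tailDeviation_le_one hδ hnm)

end IsPreferentialAttachmentA

/-! ## Convergence in probability along a filter -/

section Whp

variable {ι Ω : Type*} [MeasurableSpace Ω]

/-- The filter of those families of events, indexed by `ι`, whose complements have measure tending
to zero along `l`. For a probability measure, convergence along it is convergence in probability,
and it makes the calculus of limits along filters available for such convergence. -/
def whp (P : Measure Ω) (l : Filter ι) : Filter (ι × Ω) where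
  sets := {A | Tendsto (fun i => P {ω | (i, ω) ∉ A}) l (𝓝 0)}
  univ_sets := by simp [tendsto_const_nhds]
  sets_of_superset := fun hA hAB => tendsto_of_tendsto_of_tendsto_of_le_of_le tendsto_const_nhds hA
    (fun _ => zero_le) fun _ => measure_mono fun _ => mt (@hAB _)
  inter_sets := fun {A B} hA hB => by
    refine tendsto_of_tendsto_of_tendsto_of_le_of_le tendsto_const_nhds
      (by simpa using Tendsto.add hA hB) (fun _ => zero_le) fun i => ?_
    refine (measure_mono fun ω hω => ?_).trans (measure_union_le _ _)
    exact not_and_or.1 hω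

variable {P : Measure Ω} {l : Filter ι}

theorem eventually_whp {p : ι × Ω → Prop} :
    (∀ᶠ x in whp P l, p x) ↔ Tendsto (fun i => P {ω | ¬ p (i, ω)}) l (𝓝 0) :=
  Iff.rfl

theorem tendsto_fst_whp : Tendsto Prod.fst (whp P l) l := fun s hs => by
  refine eventually_whp.2 (tendsto_const_nhds.congr' ?_)
  filter_upwards [hs] with i hi
  simp [hi]

theorem tendsto_whp_iff_tendstoInMeasure {E : Type*} [PseudoEMetricSpace E] {X : ι → Ω → E}
    {c : E} :
    Tendsto (fun x : ι × Ω => X x.1 x.2) (whp P l) (𝓝 c) ↔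
      TendstoInMeasure P X l fun _ => c := by
  simp only [EMetric.tendsto_nhds, eventually_whp, not_lt, TendstoInMeasure]

theorem tendsto_whp_zero_of_tendsto_lintegral {X : ι → Ω → ℝ≥0∞}
    (hX : ∀ᶠ i in l, AEMeasurable (X i) P) (hlim : Tendsto (fun i => ∫⁻ ω, X i ω ∂P) l (𝓝 0)) :
    Tendsto (fun x : ι × Ω => X x.1 x.2) (whp P l) (𝓝 0) := by
  refine ENNReal.tendsto_nhds_zero.2 fun ε hε => ?_
  rcases eq_or_ne ε ∞ with rfl | hε'
  · simp
  have hdiv : Tendsto (fun i => (∫⁻ ω, X i ω ∂P) / ε) l (𝓝 0) := by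
    simpa using ENNReal.Tendsto.div_const hlim (.inr hε.ne')
  refine eventually_whp.2 (tendsto_of_tendsto_of_tendsto_of_le_of_le' tendsto_const_nhds hdiv
    (.of_forall fun _ => zero_le) ?_)
  filter_upwards [hX] with i hi
  exact (measure_mono fun ω hω => (not_le.1 hω).le).trans
    (meas_ge_le_lintegral_div hi hε.ne' hε')

theorem tendsto_whp_zero_of_tendsto_lintegral_sq {X : ι → Ω → ℝ}
    (hX : ∀ᶠ i in l, AEMeasurable (X i) P)
    (hlim : Tendsto (fun i => ∫⁻ ω, ENNReal.ofReal (X i ω ^ 2) ∂P) l (𝓝 0)) :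
    Tendsto (fun x : ι × Ω => X x.1 x.2) (whp P l) (𝓝 0) := by
  have hsq := tendsto_whp_zero_of_tendsto_lintegral
    (hX.mono fun i hi => (hi.pow_const 2).ennreal_ofReal) hlim
  have habs := ((ENNReal.tendsto_toReal ENNReal.zero_ne_top).comp hsq).sqrt
  rw [ENNReal.toReal_zero, Real.sqrt_zero] at habs
  refine tendsto_zero_iff_abs_tendsto_zero _ |>.2 (habs.congr fun x => ?_)
  simp only [Function.comp_apply, ENNReal.toReal_ofReal (sq_nonneg _), Real.sqrt_sq_eq_abs]

theorem tendstoInDistribution_const_of_tendsto_whp [IsProbabilityMeasure P]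
    [l.IsCountablyGenerated] {E : Type*} [TopologicalSpace E] [MeasurableSpace E]
    [OpensMeasurableSpace E] {X : ι → Ω → E} {c : E} (hX : ∀ i, AEMeasurable (X i) P)
    (hlim : Tendsto (fun x : ι × Ω => X x.1 x.2) (whp P l) (𝓝 c)) :
    TendstoInDistribution X l (fun _ : Ω => c) (fun _ => P) P where
  forall_aemeasurable := hX
  aemeasurable_limit := aemeasurable_const
  tendsto := by
    refine tendsto_of_forall_isOpen_le_liminf' fun U hU => ?_
    simp only [ProbabilityMeasure.coe_mk]
    rw [Measure.map_apply_of_aemeasurable aemeasurable_const hU.measurableSet]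
    by_cases hc : c ∈ U
    · have hout : Tendsto (fun i => P {ω | X i ω ∉ U}) l (𝓝 0) := hlim (hU.mem_nhds hc)
      have hin : Tendsto (fun i => 1 - P {ω | X i ω ∉ U}) l (𝓝 (1 - 0)) :=
        ENNReal.Tendsto.sub tendsto_const_nhds hout (.inl ENNReal.one_ne_top)
      rcases l.eq_or_neBot with rfl | hl
      · simp
      rw [tsub_zero] at hin
      refine prob_le_one.trans (hin.liminf_eq.ge.trans (liminf_le_liminf (.of_forall fun i => ?_)))
      rw [Measure.map_apply_of_aemeasurable (hX i) hU.measurableSet, tsub_le_iff_right,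
        ← measure_univ (μ := P)]
      exact (measure_mono fun ω _ => em (X i ω ∈ U)).trans (measure_union_le _ _)
    · simp [hc]

end Whp

theorem tendsto_apply_of_antitone {ι : Type*} {l : Filter ι} {F : ι → ℝ → ℝ} {f : ℝ → ℝ}
    {u : ι → ℝ} {x : ℝ} (hF : ∀ᶠ i in l, Antitone (F i))
    (hlim : ∀ᶠ y in 𝓝 x, Tendsto (fun i => F i y) l (𝓝 (f y))) (hf : ContinuousAt f x)
    (hu : Tendsto u l (𝓝 x)) : Tendsto (fun i => F i (u i)) l (𝓝 (f x)) := by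
  refine tendsto_order.2 ⟨fun a ha => ?_, fun a ha => ?_⟩
  · obtain ⟨y, ⟨hay, hy⟩, hxy : x < y⟩ := (((hf.eventually_const_lt ha).and hlim).filter_mono
      nhdsWithin_le_nhds |>.and self_mem_nhdsWithin : ∀ᶠ y in 𝓝[>] x, _).exists
    filter_upwards [hy.eventually_const_lt hay, hu.eventually_lt_const hxy, hF]
      with i hi hui hFi
    exact hi.trans_le (hFi hui.le)
  · obtain ⟨y, ⟨hay, hy⟩, hxy : y < x⟩ := (((hf.eventually_lt_const ha).and hlim).filter_mono
      nhdsWithin_le_nhds |>.and self_mem_nhdsWithin : ∀ᶠ y in 𝓝[<] x, _).exists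
    filter_upwards [hy.eventually_lt_const hay, hu.eventually_const_lt hxy, hF]
      with i hi hui hFi
    exact (hFi hui.le).trans_lt hi

/-! ## Order statistics -/

theorem getD_iff_lt_countP_of_pairwise {α : Type*} {r : α → α → Prop} {p : α → Prop}
    [DecidablePred p] (hp : ∀ a b, r a b → p b → p a) {d : α} (hd : ¬ p d) {l : List α}
    (hl : l.Pairwise r) (i : ℕ) : p (l.getD i d) ↔ i < l.countP p := by
  induction l generalizing i with
  | nil => simpa
  | cons a l ih =>
    obtain ⟨ha, hl⟩ := List.pairwise_cons.1 hl
    by_cases hpa : p a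
    · cases i with
      | zero => simp [hpa]
      | succ i => simpa [hpa] using ih hl i
    · have hcount : l.countP p = 0 := by
        simpa using fun b hb => mt (hp a b (ha b hb)) hpa
      cases i with
      | zero => simpa [hpa] using hcount
      | succ i => simpa [hpa, hcount] using ih hl i

namespace LabelledMultigraph

theorem lt_orderedDegree_iff (g : LabelledMultigraph) (n : ℕ) {j : ℕ} (hj : 1 ≤ j) {z : ℝ}
    (hz : 0 ≤ z) : z < g.orderedDegree n j ↔ j ≤ g.exceedanceCount n z := by
  have hmono : ∀ a b : ℕ, a ≥ b → z < b → z < a := fun a b hab hzb =>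
    hzb.trans_le (by exact_mod_cast hab)
  rw [orderedDegree, getD_iff_lt_countP_of_pairwise (p := fun a : ℕ => z < a) hmono
      (by simpa using hz) (Multiset.pairwise_sort _ _), ← Multiset.coe_countP, Multiset.sort_eq,
    Multiset.countP_map, exceedanceCount, Finset.card_def, Finset.filter_val]
  omega

end LabelledMultigraph

/-! ## Intermediate sequences -/

section IntermediateSequence

variable {k : ℕ → ℕ}

theorem tendsto_div_sqrt_of_liminf_pos
    (hk : 0 < liminf (fun n : ℕ => (((k n : ℝ) / √((n : ℝ) * Real.log n) : ℝ) : EReal)) atTop) :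
    Tendsto (fun n : ℕ => (k n : ℝ) / √n) atTop atTop := by
  obtain ⟨c, hc₀, hc⟩ := EReal.lt_iff_exists_real_btwn.1 hk
  have hlog : Tendsto (fun n : ℕ => √(Real.log n)) atTop atTop :=
    Real.tendsto_sqrt_atTop.comp (Real.tendsto_log_atTop.comp tendsto_natCast_atTop_atTop)
  refine tendsto_atTop_mono' _ ?_ (hlog.const_mul_atTop (EReal.coe_pos.1 hc₀))
  filter_upwards [eventually_lt_of_lt_liminf hc, hlog.eventually_gt_atTop 0] with n hn hlogn
  rw [EReal.coe_lt_coe_iff, Real.sqrt_mul n.cast_nonneg, ← div_div, lt_div_iff₀ hlogn] at hn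
  exact hn.le

section

variable (hk_sqrt : Tendsto (fun n : ℕ => (k n : ℝ) / √n) atTop atTop)
include hk_sqrt

theorem tendsto_natCast_atTop_of_tendsto_div_sqrt :
    Tendsto (fun n => (k n : ℝ)) atTop atTop := by
  refine tendsto_atTop_mono' _ ?_ hk_sqrt
  filter_upwards [eventually_ge_atTop 1] with n hn
  exact div_le_self (k n).cast_nonneg (Real.one_le_sqrt.2 (by exact_mod_cast hn))

theorem tendsto_div_sq_of_tendsto_div_sqrt :
    Tendsto (fun n : ℕ => (n : ℝ) / (k n : ℝ) ^ 2) atTop (𝓝 0) := by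
  refine (((tendsto_pow_atTop two_ne_zero).comp hk_sqrt).inv_tendsto_atTop).congr fun n => ?_
  simp [div_pow, Real.sq_sqrt]

theorem tendsto_div_atTop_of_tendsto_div_zero
    (hk_zero : Tendsto (fun n : ℕ => (k n : ℝ) / n) atTop (𝓝 0)) :
    Tendsto (fun n : ℕ => (n : ℝ) / k n) atTop atTop := by
  have hpos : ∀ᶠ n : ℕ in atTop, (k n : ℝ) / n ∈ Ioi 0 := by
    filter_upwards [(tendsto_natCast_atTop_of_tendsto_div_sqrt hk_sqrt).eventually_gt_atTop 0,
      eventually_gt_atTop 0] with n hk hn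
    exact div_pos hk (by exact_mod_cast hn)
  simpa only [Function.comp_def, inv_div] using
    tendsto_inv_nhdsGT_zero.comp (tendsto_nhdsWithin_iff.2 ⟨hk_zero, hpos⟩)

end
end IntermediateSequence

/-! ## Concentration of the degree counts and of the order statistics -/

namespace IsPreferentialAttachmentA

open LabelledMultigraph

variable {Ω : Type*} [MeasurableSpace Ω] {P : Measure Ω} [IsProbabilityMeasure P] {δ : ℝ}
  {G : ℕ → Ω → LabelledMultigraph} {k : ℕ → ℕ}

variable (hG : IsPreferentialAttachmentA P δ G) (hδ : -1 < δ)
include hG hδ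

theorem tendsto_tailDeviation_div {a : ℕ → ℝ}
    (ha : Tendsto (fun n : ℕ => (n : ℝ) / a n ^ 2) atTop (𝓝 0)) (m : ℕ → ℕ) :
    Tendsto (fun x : ℕ × Ω => tailDeviation δ x.1 (m x.1) (G x.1 x.2) / a x.1) (whp P atTop)
      (𝓝 0) := by
  refine tendsto_whp_zero_of_tendsto_lintegral_sq
    (X := fun n ω => tailDeviation δ n (m n) (G n ω) / a n) ?_ ?_
  · filter_upwards [eventually_ge_atTop 1] with n hn
    exact (((Measurable.of_discrete (f := tailDeviation δ n (m n))).comp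
      (hG.measurable hn)).div_const _).aemeasurable
  refine tendsto_of_tendsto_of_tendsto_of_le_of_le' tendsto_const_nhds
    (ENNReal.ofReal_zero ▸ ENNReal.tendsto_ofReal ha) (.of_forall fun _ => zero_le) ?_
  filter_upwards [eventually_ge_atTop 1] with n hn
  have hinv : 0 ≤ (a n ^ 2)⁻¹ := by positivity
  simp only [div_pow, div_eq_mul_inv _ (a n ^ 2), ENNReal.ofReal_mul' hinv]
  rw [lintegral_mul_const' _ _ ENNReal.ofReal_ne_top, ENNReal.ofReal_natCast]
  gcongr
  exact hG.lintegral_sq_tailDeviation_le hδ hn (m n)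

variable (hk_sqrt : Tendsto (fun n : ℕ => (k n : ℝ) / √n) atTop atTop)
  (hk_zero : Tendsto (fun n : ℕ => (k n : ℝ) / n) atTop (𝓝 0))
include hk_sqrt hk_zero

theorem tendsto_exceedanceCount_div {y : ℝ} (hy : 0 < y) :
    Tendsto (fun x : ℕ × Ω =>
      ((G x.1 x.2).exceedanceCount x.1 (y * scaleB δ ((x.1 : ℝ) / k x.1)) : ℝ) / k x.1)
      (whp P atTop) (𝓝 (y ^ (-(2 + δ)))) := by
  have hdiv := tendsto_div_atTop_of_tendsto_div_zero hk_sqrt hk_zero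
  have hdev := hG.tendsto_tailDeviation_div hδ (tendsto_div_sq_of_tendsto_div_sqrt hk_sqrt)
    fun n => ⌊y * scaleB δ ((n : ℝ) / k n)⌋₊
  have hmean := ((tendsto_mul_tailWeight_floor_mul_scaleB hδ hy).comp hdiv).comp
    (tendsto_fst_whp (P := P))
  have hscale : ∀ᶠ n : ℕ in atTop, 0 ≤ y * scaleB δ ((n : ℝ) / k n) := by
    filter_upwards [hdiv.eventually_gt_atTop 0] with n hn
    exact (mul_pos hy (scaleB_pos hδ hn)).le
  rw [← zero_add (y ^ _)]
  refine (hdev.add hmean).congr' ?_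
  filter_upwards [tendsto_fst_whp.eventually hscale] with x hx
  rw [← exceedanceCount_natFloor _ _ hx]
  simp only [tailDeviation, Function.comp_apply]
  ring

theorem tendsto_orderedDegree_div_scaleB {t : ℝ} (ht : 0 < t) :
    Tendsto (fun x : ℕ × Ω =>
      ((G x.1 x.2).orderedDegree x.1 ⌊(k x.1 : ℝ) * t⌋₊ : ℝ) / scaleB δ ((x.1 : ℝ) / k x.1))
      (whp P atTop) (𝓝 (t ^ (-(1 / (2 + δ))))) := by
  have hα : -(2 + δ) < 0 := by linarith
  have hk := tendsto_natCast_atTop_of_tendsto_div_sqrt hk_sqrt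
  have hfloor : Tendsto (fun x : ℕ × Ω => (⌊(k x.1 : ℝ) * t⌋₊ : ℝ) / k x.1) (whp P atTop)
      (𝓝 t) := by
    simpa only [mul_comm, Function.comp_def] using
      ((tendsto_nat_floor_mul_div_atTop ht.le).comp hk).comp tendsto_fst_whp
  have hinversion {y : ℝ} (hy : 0 < y) : ∀ᶠ x : ℕ × Ω in whp P atTop,
      y < (G x.1 x.2).orderedDegree x.1 ⌊(k x.1 : ℝ) * t⌋₊ / scaleB δ ((x.1 : ℝ) / k x.1) ↔
        (⌊(k x.1 : ℝ) * t⌋₊ : ℝ) / k x.1 ≤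
          (G x.1 x.2).exceedanceCount x.1 (y * scaleB δ ((x.1 : ℝ) / k x.1)) / k x.1 := by
    have hdiv := tendsto_div_atTop_of_tendsto_div_zero hk_sqrt hk_zero
    filter_upwards [tendsto_fst_whp.eventually (hdiv.eventually_gt_atTop 0),
      tendsto_fst_whp.eventually (hk.eventually_gt_atTop 0),
      tendsto_fst_whp.eventually ((hk.atTop_mul_const ht).eventually_ge_atTop 1)] with x hnk hk hkt
    have hb := scaleB_pos hδ hnk
    rw [lt_div_iff₀ hb, div_le_div_iff_of_pos_right hk, Nat.cast_le,
      lt_orderedDegree_iff _ _ (Nat.le_floor (by simpa using hkt)) (by positivity)]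
  rw [one_div, ← inv_neg]
  refine tendsto_order.2 ⟨fun a ha => ?_, fun a ha => ?_⟩
  · obtain ⟨y, hay, hy⟩ := exists_between (max_lt ha (Real.rpow_pos_of_pos ht (-(2 + δ))⁻¹))
    obtain ⟨hay, hy₀⟩ := max_lt_iff.1 hay
    rw [Real.lt_rpow_inv_iff_of_neg hy₀ ht hα] at hy
    filter_upwards [hinversion hy₀, hfloor.eventually_lt
      (hG.tendsto_exceedanceCount_div hδ hk_sqrt hk_zero hy₀) hy] with x hx hlt
    exact hay.trans (hx.2 hlt.le)
  · obtain ⟨y, hy, hya⟩ := exists_between ha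
    have hy₀ := (Real.rpow_pos_of_pos ht _).trans hy
    rw [Real.rpow_inv_lt_iff_of_neg ht hy₀ hα] at hy
    filter_upwards [hinversion hy₀,
      (hG.tendsto_exceedanceCount_div hδ hk_sqrt hk_zero hy₀).eventually_lt hfloor hy] with x hx hlt
    exact (not_lt.1 (mt hx.1 hlt.not_ge)).trans_lt hya

theorem tendsto_orderedDegree_div_scaleB_one :
    Tendsto (fun x : ℕ × Ω =>
      ((G x.1 x.2).orderedDegree x.1 (k x.1) : ℝ) / scaleB δ ((x.1 : ℝ) / k x.1))
      (whp P atTop) (𝓝 1) := by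
  simpa only [mul_one, Nat.floor_natCast, Real.one_rpow] using
    hG.tendsto_orderedDegree_div_scaleB hδ hk_sqrt hk_zero one_pos

theorem tendsto_exceedanceCount_mul_orderedDegree_div {y : ℝ} (hy : 0 < y) :
    Tendsto (fun x : ℕ × Ω =>
      ((G x.1 x.2).exceedanceCount x.1 (y * (G x.1 x.2).orderedDegree x.1 (k x.1)) : ℝ) / k x.1)
      (whp P atTop) (𝓝 (y ^ (-(2 + δ)))) := by
  have hdegree := hG.tendsto_orderedDegree_div_scaleB_one hδ hk_sqrt hk_zero
  have hlevel := hdegree.const_mul y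
  rw [mul_one] at hlevel
  have hscale : ∀ᶠ x : ℕ × Ω in whp P atTop, 0 < scaleB δ ((x.1 : ℝ) / k x.1) :=
    tendsto_fst_whp.eventually (((tendsto_div_atTop_of_tendsto_div_zero hk_sqrt
      hk_zero).eventually_gt_atTop 0).mono fun n hn => scaleB_pos hδ hn)
  have hcount := tendsto_apply_of_antitone (l := whp P atTop) (F := fun x : ℕ × Ω => fun y =>
      ((G x.1 x.2).exceedanceCount x.1 (y * scaleB δ ((x.1 : ℝ) / k x.1)) : ℝ) / k x.1)
    (f := fun y => y ^ (-(2 + δ))) ?_ ?_ (Real.continuousAt_rpow_const _ _ (.inl hy.ne')) hlevel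
  · refine hcount.congr' ?_
    filter_upwards [hscale] with x hx
    rw [mul_assoc, div_mul_cancel₀ _ hx.ne']
  · filter_upwards [hscale] with x hx y₁ y₂ hle
    have := (G x.1 x.2).exceedanceCount_antitone x.1 (mul_le_mul_of_nonneg_right hle hx.le)
    exact div_le_div_of_nonneg_right (mod_cast this) (Nat.cast_nonneg _)
  · filter_upwards [lt_mem_nhds hy] with z hz
    exact hG.tendsto_exceedanceCount_div hδ hk_sqrt hk_zero hz

end IsPreferentialAttachmentA

/-! ## Vague convergence on `(0, ∞]` -/

theorem abs_integral_sub_integral_le_of_abs_sub_le_indicator {E : Type*} [MeasurableSpace E]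
    {μ : Measure E} {f g : E → ℝ} {A : Set E} {ε : ℝ} (hf : Integrable f μ) (hg : Integrable g μ)
    (hA : MeasurableSet A) (hμA : μ A ≠ ∞)
    (hfg : ∀ y, |f y - g y| ≤ A.indicator (fun _ => ε) y) :
    |∫ y, f y ∂μ - ∫ y, g y ∂μ| ≤ μ.real A * ε := by
  rw [← integral_sub hf hg, ← smul_eq_mul, ← integral_indicator_const ε hA]
  exact norm_integral_le_of_norm_le (f := fun y => f y - g y)
    ((integrable_indicator_iff hA).2 (integrableOn_const hμA)) (.of_forall hfg)

theorem tendsto_integral_of_forall_abs_sub_le_indicator {ι E : Type*} [MeasurableSpace E]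
    {l : Filter ι} {μ : ι → Measure E} {ν : Measure E} {f : E → ℝ} {A : Set E}
    (hA : MeasurableSet A) (hμA : ∀ i, μ i A ≠ ∞) (hνA : ν A ≠ ∞)
    (hA_tendsto : Tendsto (fun i => (μ i).real A) l (𝓝 (ν.real A)))
    (hμf : ∀ i, Integrable f (μ i)) (hνf : Integrable f ν)
    (happrox : ∀ ε > 0, ∃ g : E → ℝ, (∀ i, Integrable g (μ i)) ∧ Integrable g ν ∧
      Tendsto (fun i => ∫ y, g y ∂μ i) l (𝓝 (∫ y, g y ∂ν)) ∧
      ∀ y, |f y - g y| ≤ A.indicator (fun _ => ε) y) :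
    Tendsto (fun i => ∫ y, f y ∂μ i) l (𝓝 (∫ y, f y ∂ν)) := by
  rw [Metric.tendsto_nhds]
  intro ε hε
  set m := ν.real A + 1
  have hm : 0 < m := by positivity
  obtain ⟨g, hμg, hνg, hg, hfg⟩ := happrox (ε / (3 * m)) (by positivity)
  have happrox_of_le {μ : Measure E} (hf : Integrable f μ) (hg : Integrable g μ) (hμA : μ A ≠ ∞)
      (hle : μ.real A ≤ m) : |∫ y, f y ∂μ - ∫ y, g y ∂μ| ≤ ε / 3 :=
    calc |∫ y, f y ∂μ - ∫ y, g y ∂μ| ≤ μ.real A * (ε / (3 * m)) :=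
          abs_integral_sub_integral_le_of_abs_sub_le_indicator hf hg hA hμA hfg
      _ ≤ m * (ε / (3 * m)) := by gcongr
      _ = ε / 3 := by field_simp
  filter_upwards [hA_tendsto.eventually_le_const (lt_add_one _),
    Metric.tendsto_nhds.1 hg (ε / 3) (by positivity)] with i hi hgi
  have hνfg := happrox_of_le hνf hνg hνA (lt_add_one _).le
  have hμfg := happrox_of_le (hμf i) (hμg i) (hμA i) hi
  rw [Real.dist_eq, abs_lt] at hgi ⊢
  rw [abs_le] at hνfg hμfg
  constructor <;> linarith [hνfg.1, hνfg.2, hμfg.1, hμfg.2]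

theorem sum_range_ite_lt_mul_sub (u : ℕ → ℝ) {η σ : ℝ} (hη : 0 < η) (hσ : 0 ≤ σ) {N : ℕ}
    (hN : σ < N * η) :
    ∑ j ∈ Finset.range N, (if σ < (j + 1 : ℕ) * η then u j - u (j + 1) else 0) =
      u ⌊σ / η⌋₊ - u N := by
  have hle : ⌊σ / η⌋₊ ≤ N :=
    ((Nat.floor_lt (by positivity)).2 ((div_lt_iff₀ hη).2 hN)).le
  have hfilter : {j ∈ Finset.range N | σ < (j + 1 : ℕ) * η} = Finset.Ico ⌊σ / η⌋₊ N := by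
    ext j
    rw [Finset.mem_filter, Finset.mem_range, Finset.mem_Ico, ← div_lt_iff₀ hη,
      ← Nat.floor_lt (by positivity), Nat.lt_succ_iff, and_comm]
  rw [← Finset.sum_filter, hfilter, ← neg_inj, ← Finset.sum_neg_distrib]
  simp only [neg_sub]
  exact Finset.sum_Ico_sub u hle

theorem exists_abs_sub_sum_ite_lt_le {h : ℝ → ℝ} (hh : Continuous h) {S : ℝ} (hS : 0 < S)
    (hzero : ∀ s, S ≤ s → h s = 0) {ε : ℝ} (hε : 0 < ε) :
    ∃ (N : ℕ) (c x : ℕ → ℝ), (∀ j, 0 < x j) ∧ ∀ σ, 0 ≤ σ →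
      |h σ - ∑ j ∈ Finset.range N, if σ < x j then c j else 0| ≤ if σ < S then ε else 0 := by
  obtain ⟨η₀, hη₀, hη₀h⟩ := Metric.uniformContinuousOn_iff.1
    (isCompact_Icc.uniformContinuousOn_of_continuous (hh.continuousOn (s := Icc 0 S))) ε hε
  obtain ⟨N, hN⟩ := exists_nat_gt (S / η₀)
  have hN₀ : (0 : ℝ) < N := lt_trans (by positivity) hN
  set η := S / N
  have hη : 0 < η := by positivity
  have hηη₀ : η < η₀ := (div_lt_comm₀ hη₀ hN₀).1 hN
  have hNη : N * η = S := mul_div_cancel₀ _ hN₀.ne'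
  refine ⟨N, fun j => h (j * η) - h ((j + 1 : ℕ) * η), fun j => (j + 1 : ℕ) * η,
    fun j => by positivity, fun σ hσ => ?_⟩
  split_ifs with hσS
  · rw [sum_range_ite_lt_mul_sub (fun j => h (j * η)) hη hσ (by rwa [hNη]), hNη,
      hzero S le_rfl, sub_zero]
    have hfloor_le : ⌊σ / η⌋₊ * η ≤ σ := (le_div_iff₀ hη).1 (Nat.floor_le (by positivity))
    have hlt_floor : σ < (⌊σ / η⌋₊ + 1) * η := (div_lt_iff₀ hη).1 (Nat.lt_floor_add_one _)
    refine (hη₀h σ ⟨hσ, hσS.le⟩ _ ⟨by positivity, hfloor_le.trans hσS.le⟩ ?_).le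
    rw [Real.dist_eq, abs_of_nonneg (sub_nonneg.2 hfloor_le)]
    linarith
  · have hright : ∀ j ∈ Finset.range N, ¬ σ < (j + 1 : ℕ) * η := fun j hj => not_lt.2 <|
      calc (j + 1 : ℕ) * η ≤ N * η := by gcongr; exact Finset.mem_range.1 hj
        _ ≤ σ := hNη.le.trans (not_lt.1 hσS)
    rw [Finset.sum_eq_zero fun j hj => if_neg (hright j hj), hzero σ (not_lt.1 hσS), sub_zero,
      abs_zero]

namespace PosExtended

/-- The set `(x, ∞]` in `(0, ∞]`; for `x ≤ 0` it is the whole space. -/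
def tail (x : ℝ) : Set PosExtended := {y | ENNReal.ofReal x < y.1}

theorem measurableSet_tail (x : ℝ) : MeasurableSet (tail x) :=
  (isOpen_Ioi.preimage continuous_subtype_val).measurableSet

theorem val_image_tail (x : ℝ) : Subtype.val '' tail x = Ioi (ENNReal.ofReal x) :=
  (Subtype.image_preimage_val _ _).trans (inter_eq_right.2 (Ioi_subset_Ioi zero_le))

theorem mem_tail_inv_iff {x : ℝ} (hx : 0 < x) (y : PosExtended) :
    y ∈ tail x⁻¹ ↔ (y.1⁻¹).toReal < x := by
  rw [tail, mem_ofPred_eq, ENNReal.ofReal_inv_of_pos hx, ENNReal.inv_lt_iff_inv_lt,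
    ENNReal.lt_ofReal_iff_toReal_lt (ENNReal.inv_ne_top.2 y.2.ne')]

theorem isCompact_setOf_ofReal_le {x : ℝ} (hx : 0 < x) :
    IsCompact {y : PosExtended | ENNReal.ofReal x ≤ y.1} := by
  have himage : Subtype.val '' {y : PosExtended | ENNReal.ofReal x ≤ y.1} =
      Ici (ENNReal.ofReal x) :=
    (Subtype.image_preimage_val _ _).trans
      (inter_eq_right.2 (Ici_subset_Ioi.2 (ENNReal.ofReal_pos.2 hx)))
  rw [Topology.IsInducing.subtypeVal.isCompact_iff, himage]
  exact isClosed_Ici.isCompact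

theorem measure_tail_ne_top (μ : RadonMeasures PosExtended) {x : ℝ} (hx : 0 < x) :
    μ.1 (tail x) ≠ ∞ :=
  have := μ.2
  measure_ne_top_of_subset (fun y (hy : ENNReal.ofReal x < y.1) => hy.le)
    (isCompact_setOf_ofReal_le hx).measure_ne_top

theorem integrable_indicator_tail (μ : RadonMeasures PosExtended) {x : ℝ} (hx : 0 < x) (c : ℝ) :
    Integrable ((tail x).indicator fun _ => c) μ.1 :=
  (integrable_indicator_iff (measurableSet_tail x)).2
    (integrableOn_const (measure_tail_ne_top μ hx))

theorem exists_support_subset_tail (f : C_c(PosExtended, ℝ)) :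
    ∃ x > 0, Function.support f ⊆ tail x := by
  rcases (tsupport f).eq_empty_or_nonempty with hempty | hne
  · exact ⟨1, one_pos, (subset_tsupport f).trans (hempty ▸ empty_subset _)⟩
  · obtain ⟨y₀, _, hmin⟩ := f.hasCompactSupport.isCompact.exists_isMinOn hne
      continuous_subtype_val.continuousOn
    obtain ⟨x, _, hxy₀⟩ := ENNReal.lt_iff_exists_real_btwn.1 y₀.2
    exact ⟨x, ENNReal.ofReal_pos.1 hxy₀.1,
      fun y hy => hxy₀.2.trans_le (hmin (subset_tsupport f hy))⟩

theorem exists_abs_sub_sum_indicator_tail_le (f : C_c(PosExtended, ℝ)) :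
    ∃ a > 0, ∀ ε > 0, ∃ (N : ℕ) (c x : ℕ → ℝ), (∀ j, 0 < x j) ∧
      ∀ y, |f y - ∑ j ∈ Finset.range N, (tail (x j)).indicator (fun _ => c j) y| ≤
        (tail a).indicator (fun _ => ε) y := by
  classical
  obtain ⟨a, ha, hsupport⟩ := exists_support_subset_tail f
  refine ⟨a, ha, fun ε hε => ?_⟩
  let h : ℝ → ℝ := fun s => f ⟨(ENNReal.ofReal s)⁻¹, ENNReal.inv_pos.2 ENNReal.ofReal_ne_top⟩
  have hh : Continuous h :=
    f.continuous.comp ((continuous_inv.comp ENNReal.continuous_ofReal).subtype_mk _)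
  have hfh (y : PosExtended) : f y = h (y.1⁻¹).toReal := by
    refine congrArg f (Subtype.ext ?_)
    change y.1 = (ENNReal.ofReal (y.1⁻¹).toReal)⁻¹
    rw [ENNReal.ofReal_toReal (ENNReal.inv_ne_top.2 y.2.ne'), inv_inv]
  have hzero : ∀ s, a⁻¹ ≤ s → h s = 0 := fun s hs => by
    have hs₀ : 0 < s := (inv_pos.2 ha).trans_le hs
    refine Function.notMem_support.1 fun hne => ?_
    have hlt := hsupport hne
    rw [← inv_inv a, mem_tail_inv_iff (inv_pos.2 ha)] at hlt
    simp only [inv_inv, ENNReal.toReal_ofReal hs₀.le] at hlt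
    exact hlt.not_ge hs
  obtain ⟨N, c, x, hx, hle⟩ := exists_abs_sub_sum_ite_lt_le hh (inv_pos.2 ha) hzero hε
  refine ⟨N, c, fun j => (x j)⁻¹, fun j => inv_pos.2 (hx j), fun y => ?_⟩
  conv_rhs => rw [← inv_inv a]
  simpa only [indicator_apply, mem_tail_inv_iff (hx _), mem_tail_inv_iff (inv_pos.2 ha), ← hfh]
    using hle (y.1⁻¹).toReal ENNReal.toReal_nonneg

theorem tendsto_of_tendsto_real_tail {ι : Type*} {l : Filter ι} {μ : ι → RadonMeasures PosExtended}
    {ν : RadonMeasures PosExtended}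
    (h : ∀ x > 0, Tendsto (fun i => (μ i).1.real (tail x)) l (𝓝 (ν.1.real (tail x)))) :
    Tendsto μ l (𝓝 ν) := by
  rw [nhds_induced, tendsto_comap_iff, tendsto_pi_nhds]
  intro f
  have hf (μ : RadonMeasures PosExtended) : Integrable f μ.1 :=
    have := μ.2
    f.continuous.integrable_of_hasCompactSupport f.hasCompactSupport
  obtain ⟨a, ha, happrox⟩ := exists_abs_sub_sum_indicator_tail_le f
  refine tendsto_integral_of_forall_abs_sub_le_indicator (measurableSet_tail a)
    (fun i => measure_tail_ne_top (μ i) ha) (measure_tail_ne_top ν ha) (h a ha)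
    (fun i => hf (μ i)) (hf ν) fun ε hε => ?_
  obtain ⟨N, c, x, hx, hle⟩ := happrox ε hε
  have hint (μ : RadonMeasures PosExtended) (j : ℕ) :
      Integrable ((tail (x j)).indicator fun _ => c j) μ.1 :=
    integrable_indicator_tail μ (hx j) (c j)
  have hintegral (μ : RadonMeasures PosExtended) :
      ∫ y, ∑ j ∈ Finset.range N, (tail (x j)).indicator (fun _ => c j) y ∂μ.1 =
        ∑ j ∈ Finset.range N, μ.1.real (tail (x j)) * c j := by
    rw [integral_finsetSum _ fun j _ => hint μ j]
    exact Finset.sum_congr rfl fun j _ => integral_indicator_const _ (measurableSet_tail _)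
  refine ⟨_, fun i => integrable_finsetSum _ fun j _ => hint (μ i) j,
    integrable_finsetSum _ fun j _ => hint ν j, ?_, hle⟩
  simp only [hintegral]
  exact tendsto_finsetSum _ fun j _ => (h _ (hx j)).mul_const _

end PosExtended

theorem real_nuMeasure_tail {α x : ℝ} (hα : 0 < α) (hx : 0 < x) :
    (nuMeasure α).1.real (PosExtended.tail x) = x ^ (-α) := by
  rw [Measure.real, nuMeasure, PosExtended.tail, powerMeasure_Ioi hα hx,
    ENNReal.toReal_ofReal (by positivity)]

namespace LabelledMultigraph

theorem real_tailEmpiricalMeasure_tail (g : LabelledMultigraph) {n k : ℕ} {x : ℝ} (hx : 0 < x)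
    (hD : 0 < g.orderedDegree n k) :
    (tailEmpiricalMeasure g n k).1.real (PosExtended.tail x) =
      g.exceedanceCount n (x * g.orderedDegree n k) / k := by
  have hmem (i : ℕ) : (g.degree i : ℝ≥0∞) / (g.orderedDegree n k : ℝ≥0∞) ∈
      Ioi (ENNReal.ofReal x) ↔ x * g.orderedDegree n k < g.degree i := by
    rw [mem_Ioi, ENNReal.lt_div_iff_mul_lt (.inl (mod_cast hD.ne'))
      (.inl (ENNReal.natCast_ne_top _)), ← ENNReal.ofReal_natCast, ← ENNReal.ofReal_natCast,
      ← ENNReal.ofReal_mul hx.le, ENNReal.ofReal_lt_ofReal_iff_of_nonneg (by positivity)]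
  have hmeasure : (tailEmpiricalMeasure g n k).1 (PosExtended.tail x) =
      ((k : ℝ≥0)⁻¹ : ℝ≥0) * (g.exceedanceCount n (x * g.orderedDegree n k) : ℝ≥0∞) := by
    rw [tailEmpiricalMeasure, restrictPosExtended,
      (MeasurableEmbedding.subtype_coe measurableSet_Ioi).comap_apply, PosExtended.val_image_tail,
      Measure.smul_apply, Measure.finsetSum_apply, ENNReal.smul_def, smul_eq_mul,
      exceedanceCount, Finset.card_filter, Nat.cast_sum]
    congr! 2 with i
    rw [Measure.dirac_apply' _ measurableSet_Ioi, indicator_apply]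
    simp only [hmem, Pi.one_apply, Nat.cast_ite, Nat.cast_one, Nat.cast_zero]
  rw [Measure.real, hmeasure, ENNReal.toReal_mul, ENNReal.coe_toReal, ENNReal.toReal_natCast,
    NNReal.coe_inv, NNReal.coe_natCast, inv_mul_eq_div]

end LabelledMultigraph

namespace IsPreferentialAttachmentA

variable {Ω : Type*} [MeasurableSpace Ω] {P : Measure Ω} {δ : ℝ} {G : ℕ → Ω → LabelledMultigraph}
  (hG : IsPreferentialAttachmentA P δ G)
include hG

theorem measurable_tailEmpiricalMeasure (n k : ℕ) :
    Measurable fun ω => tailEmpiricalMeasure (G n ω) n k := by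
  rcases n.eq_zero_or_pos with rfl | hn
  · have hconst (g : LabelledMultigraph) :
        tailEmpiricalMeasure g 0 k = tailEmpiricalMeasure 0 0 k := by
      simp [tailEmpiricalMeasure]
    simp only [hconst, measurable_const]
  · exact (Measurable.of_discrete (f := fun g => tailEmpiricalMeasure g n k)).comp
      (hG.measurable hn)

variable [IsProbabilityMeasure P] {k : ℕ → ℕ} (hδ : -1 < δ)
  (hk_sqrt : Tendsto (fun n : ℕ => (k n : ℝ) / √n) atTop atTop)
  (hk_zero : Tendsto (fun n : ℕ => (k n : ℝ) / n) atTop (𝓝 0))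
include hδ hk_sqrt hk_zero

theorem tendsto_tailEmpiricalMeasure :
    Tendsto (fun x : ℕ × Ω => tailEmpiricalMeasure (G x.1 x.2) x.1 (k x.1)) (whp P atTop)
      (𝓝 (nuMeasure (2 + δ))) := by
  refine PosExtended.tendsto_of_tendsto_real_tail fun y hy => ?_
  rw [real_nuMeasure_tail (by linarith) hy]
  refine (hG.tendsto_exceedanceCount_mul_orderedDegree_div hδ hk_sqrt hk_zero hy).congr' ?_
  filter_upwards [(hG.tendsto_orderedDegree_div_scaleB_one hδ hk_sqrt hk_zero).eventually_ne
    one_ne_zero] with x hx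
  have hdegree_ne : (G x.1 x.2).orderedDegree x.1 (k x.1) ≠ 0 := by
    rintro hzero
    simp [hzero] at hx
  exact ((G x.1 x.2).real_tailEmpiricalMeasure_tail hy (Nat.pos_of_ne_zero hdegree_ne)).symm

end IsPreferentialAttachmentA

theorem mainTheorem2_general {Ω : Type*} [MeasurableSpace Ω] (P : Measure Ω)
    [IsProbabilityMeasure P] (δ : ℝ) (hδ : -1 < δ) (G : ℕ → Ω → LabelledMultigraph)
    (hG : IsPreferentialAttachmentA P δ G) (k : ℕ → ℕ)
    (hk_sqrt : Tendsto (fun n : ℕ => (k n : ℝ) / √n) atTop atTop)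
    (hk_zero : Tendsto (fun n : ℕ => (k n : ℝ) / n) atTop (𝓝 0)) :
    TendstoInDistribution (fun n ω => tailEmpiricalMeasure (G n ω) n (k n)) atTop
        (fun _ : Ω => nuMeasure (2 + δ)) (fun _ => P) P ∧
      ∀ t : ℝ, 0 < t →
        TendstoInMeasure P
          (fun n ω => ((G n ω).orderedDegree n ⌊(k n : ℝ) * t⌋₊ : ℝ) / scaleB δ ((n : ℝ) / k n))
          atTop (fun _ => t ^ (-(1 / (2 + δ)))) := by
  refine ⟨tendstoInDistribution_const_of_tendsto_whp
    (fun n => (hG.measurable_tailEmpiricalMeasure n (k n)).aemeasurable)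
    (hG.tendsto_tailEmpiricalMeasure hδ hk_sqrt hk_zero), fun t ht => ?_⟩
  exact tendsto_whp_iff_tendstoInMeasure.1
    (hG.tendsto_orderedDegree_div_scaleB hδ hk_sqrt hk_zero ht)

theorem mainTheorem2 {Ω : Type*} [MeasurableSpace Ω] (P : Measure Ω) [IsProbabilityMeasure P]
    (δ : ℝ) (hδ : -1 < δ) (G : ℕ → Ω → LabelledMultigraph)
    (hG : IsPreferentialAttachmentA P δ G) (k : ℕ → ℕ)
    (hk_liminf : 0 < Filter.liminf
      (fun n : ℕ => (((k n : ℝ) / √((n : ℝ) * Real.log n) : ℝ) : EReal)) atTop)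
    (hk_zero : Tendsto (fun n : ℕ => (k n : ℝ) / n) atTop (𝓝 0)) :
    TendstoInDistribution (fun n ω => tailEmpiricalMeasure (G n ω) n (k n)) atTop
        (fun _ : Ω => nuMeasure (2 + δ)) (fun _ => P) P ∧
      ∀ t : ℝ, 0 < t →
        TendstoInMeasure P
          (fun n ω => ((G n ω).orderedDegree n ⌊(k n : ℝ) * t⌋₊ : ℝ) / scaleB δ ((n : ℝ) / k n))
          atTop (fun _ => t ^ (-(1 / (2 + δ)))) :=
  mainTheorem2_general P δ hδ G hG k (tendsto_div_sqrt_of_liminf_pos hk_liminf) hk_zero
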